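/- Let $n\ge 1$ and let $\mathbb K$ be $\mathbb R$ or $\mathbb C$. An elastic $1$-tensor is an array $(a_{ij})_{1\le i,j\le n}$ with entries in $\mathbb K$ and $a_{ij}=a_{ji}$; an elastic $2$-tensor is an array $(a_{ijkl})_{1\le i,j,k,l\le n}$ with entries in $\mathbb K$ and $a_{ijkl}=a_{jikl}=a_{klij}$. Write $E_1$ and $E_2$ for the spaces of elastic $1$- and $2$-tensors, and $\mathscr S(\mathbb R^n;E)$ for the Schwartz functions on $\mathbb R^n$ with values in a finite-dimensional space $E$. Let $\varepsilon$ be the elastic symmetrization, which sends a rank-four tensor to its average over the eight permutations of the indices generated by $i\leftrightarrow j$, $k\leftrightarrow l$ and $(i,j)\leftrightarrow(k,l)$. Define the operators $$H\colon\mathscr S(\mathbb R^n;E_1)\to\mathscr S(\mathbb R^n;E_2),\quad Hh=\varepsilon(D^2h),\qquad (D^2h)_{ijkl}=\partial_i\partial_jh_{kl},$$ $$K\colon\mathscr S(\mathbb R^n;\mathbb K^n)\to\mathscr S(\mathbb R^n;E_2),\quad KW=\varepsilon(DW\otimes I),\qquad (DW\otimes I)_{ijkl}=\partial_iW_j\,\delta_{kl},$$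 and their formal $L^2$-adjoints $$H^*\colon\mathscr S(\mathbb R^n;E_2)\to\mathscr S(\mathbb R^n;E_1),\quad (H^*f)_{ij}=\sum_{k,l}\partial_k\partial_lf_{ijkl},$$ $$K^*\colon\mathscr S(\mathbb R^n;E_2)\to\mathscr S(\mathbb R^n;\mathbb K^n),\quad (K^*f)_i=-\sum_{j,k}\partial_jf_{ijkk}.$$ For a unit vector $v\in\mathbb R^n$ put $P_v=\mathbb Rv\cup v^\perp\subset\mathbb R^n$, and for $q\in P_v$, $f\in\mathscr S(\mathbb R^n;E_2)$ and $x\in\mathbb R^n$ let $$X^2_{v,q}f(x)=\int_{\mathbb R}\sum_{i,j,k,l}f_{ijkl}(x+tv)\,v_iq_jv_kq_l\,dt .$$ Let $\ker(X^2)$ be the set of all $f\in\mathscr S(\mathbb R^n;E_2)$ such that $X^2_{v,q}f=0$ on $\mathbb R^n$ for all unit vectors $v$ and all $q\in P_v$. Then: 1. $\operatorname{im}(H)+\operatorname{im}(K)\subset\ker(X^2)$. 2. $\ker(H^*)\cap\ker(K^*)\cap\ker(X^2)=\{0\}$. -/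

import Mathlib

open MeasureTheory
open scoped SchwartzMap

noncomputable section

namespace ElasticXRay

/-- The Euclidean space `ℝⁿ`. -/
abbrev Euc (n : ℕ) : Type := EuclideanSpace ℝ (Fin n)

/-- Vectors with components in `𝕜`. -/
abbrev Tensor1 (𝕜 : Type*) (n : ℕ) := Fin n → 𝕜

/-- Rank two tensors `a i j` over `ℝⁿ` with components in `𝕜`, without symmetries. -/
abbrev Tensor2 (𝕜 : Type*) (n : ℕ) := Fin n → Fin n → 𝕜

/-- Rank four tensors `a i j k l` over `ℝⁿ` with components in `𝕜`, without symmetries. -/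
abbrev Tensor4 (𝕜 : Type*) (n : ℕ) := Fin n → Fin n → Fin n → Fin n → 𝕜

variable (𝕜 : Type*) [RCLike 𝕜] (n : ℕ)

/-- Elastic `1`-tensors: the symmetric rank two tensors. -/
def Elastic1 : Submodule 𝕜 (Tensor2 𝕜 n) where
  carrier := {a | ∀ i j, a i j = a j i}
  zero_mem' := fun _ _ => rfl
  add_mem' := fun {a b} ha hb i j => by
    change a i j + b i j = a j i + b j i
    rw [ha i j, hb i j]
  smul_mem' := fun c a ha i j => by
    change c • a i j = c • a j i
    rw [ha i j]

/-- Elastic `2`-tensors: the symmetric square of the space of symmetric rank two tensors, that is,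
`a i j k l = a j i k l = a k l i j`. -/
def Elastic2 : Submodule 𝕜 (Tensor4 𝕜 n) where
  carrier := {a | ∀ i j k l, a i j k l = a j i k l ∧ a i j k l = a k l i j}
  zero_mem' := fun _ _ _ _ => ⟨rfl, rfl⟩
  add_mem' := fun {a b} ha hb i j k l => by
    change a i j k l + b i j k l = a j i k l + b j i k l ∧
      a i j k l + b i j k l = a k l i j + b k l i j
    exact ⟨by rw [(ha i j k l).1, (hb i j k l).1], by rw [(ha i j k l).2, (hb i j k l).2]⟩
  smul_mem' := fun c a ha i j k l => by
    change c • a i j k l = c • a j i k l ∧ c • a i j k l = c • a k l i j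
    exact ⟨by rw [(ha i j k l).1], by rw [(ha i j k l).2]⟩

instance : NormedSpace ℝ (Elastic1 𝕜 n) := Submodule.normedSpace _

instance : NormedSpace 𝕜 (Elastic1 𝕜 n) := Submodule.normedSpace _

instance : NormedSpace ℝ (Elastic2 𝕜 n) := Submodule.normedSpace _

instance : NormedSpace 𝕜 (Elastic2 𝕜 n) := Submodule.normedSpace _

/-- The elastic symmetrization operator `ε` on rank four tensors: the average over the eight
permutations of the indices that leave every elastic `2`-tensor fixed. -/
def elasticSymm : Tensor4 𝕜 n →L[𝕜] Elastic2 𝕜 n :=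
  LinearMap.toContinuousLinearMap
    { toFun := fun T => ⟨fun i j k l => (1 / 8 : 𝕜) *
          (T i j k l + T j i k l + T i j l k + T j i l k +
            T k l i j + T l k i j + T k l j i + T l k j i),
        fun i j k l => ⟨by ring, by ring⟩⟩
      map_add' := fun S T => by
        ext i j k l
        simp only [Pi.add_apply, Submodule.coe_add]
        ring
      map_smul' := fun c T => by
        ext i j k l
        simp only [Pi.smul_apply, smul_eq_mul, RingHom.id_apply, Submodule.coe_smul]
        ring }

/-- The tensor product `A ⊗ I` of a rank two tensor with the identity matrix. -/
def tensorId : Tensor2 𝕜 n →L[𝕜] Tensor4 𝕜 n :=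
  LinearMap.toContinuousLinearMap
    { toFun := fun A i j k l => A i j * (1 : Matrix (Fin n) (Fin n) 𝕜) k l
      map_add' := fun A B => by
        ext i j k l
        simp only [Pi.add_apply]
        ring
      map_smul' := fun c A => by
        ext i j k l
        simp only [Pi.smul_apply, smul_eq_mul, RingHom.id_apply]
        ring }

section Derivative

variable (F : Type*) [NormedAddCommGroup F] [NormedSpace ℝ F] [NormedSpace 𝕜 F]
  [SMulCommClass ℝ 𝕜 F]

/-- Evaluation of an `ℝ`-linear map on the standard basis of `ℝⁿ`. -/
def evalBasis : (Euc n →L[ℝ] F) →L[𝕜] (Fin n → F) :=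
  ContinuousLinearMap.pi fun j =>
    { toFun := fun L => L (EuclideanSpace.single j (1 : ℝ))
      map_add' := fun _ _ => rfl
      map_smul' := fun _ _ => rfl
      cont := (ContinuousLinearMap.apply ℝ F (EuclideanSpace.single j (1 : ℝ))).continuous }

/-- The operator `D` on Schwartz fields, `(D f)_j = ∂_j f`; the new index comes first. -/
def D : 𝓢(Euc n, F) →L[𝕜] 𝓢(Euc n, Fin n → F) :=
  SchwartzMap.postcompCLM (evalBasis 𝕜 n F) ∘L SchwartzMap.fderivCLM 𝕜 (Euc n) F

end Derivative

/-- The operator `H₂ h = ε(D² h)` from Schwartz elastic `1`-tensor fields to Schwartz elastic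
`2`-tensor fields. -/
def H : 𝓢(Euc n, Elastic1 𝕜 n) →L[𝕜] 𝓢(Euc n, Elastic2 𝕜 n) :=
  SchwartzMap.postcompCLM (elasticSymm 𝕜 n) ∘L D 𝕜 n (Fin n → Tensor2 𝕜 n) ∘L
    D 𝕜 n (Tensor2 𝕜 n) ∘L SchwartzMap.postcompCLM (Elastic1 𝕜 n).subtypeL

/-- The operator `K W = ε(D W ⊗ I)` from Schwartz vector fields to Schwartz elastic
`2`-tensor fields. -/
def K : 𝓢(Euc n, Tensor1 𝕜 n) →L[𝕜] 𝓢(Euc n, Elastic2 𝕜 n) :=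
  SchwartzMap.postcompCLM (elasticSymm 𝕜 n ∘L tensorId 𝕜 n) ∘L D 𝕜 n (Tensor1 𝕜 n)

/-- The contraction `(T k l i j p q) ↦ ∑ k l, T k l i j k l`. -/
def contractH : (Fin n → Fin n → Elastic2 𝕜 n) →L[𝕜] Elastic1 𝕜 n :=
  LinearMap.toContinuousLinearMap
    { toFun := fun T => ⟨fun i j => ∑ k, ∑ l, (T k l).1 i j k l, fun i j =>
        Finset.sum_congr rfl fun k _ => Finset.sum_congr rfl fun l _ =>
          ((T k l).2 i j k l).1⟩
      map_add' := fun S T => by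
        ext i j
        simp [Finset.sum_add_distrib]
      map_smul' := fun c T => by
        ext i j
        simp [Finset.mul_sum] }

/-- The formal `L²` adjoint of `H`: `(H* f)_{ij} = ∑ k l, ∂_k ∂_l f_{ijkl}`. -/
def Hstar : 𝓢(Euc n, Elastic2 𝕜 n) →L[𝕜] 𝓢(Euc n, Elastic1 𝕜 n) :=
  SchwartzMap.postcompCLM (contractH 𝕜 n) ∘L D 𝕜 n (Fin n → Elastic2 𝕜 n) ∘L
    D 𝕜 n (Elastic2 𝕜 n)

/-- The contraction `(T j i p k l) ↦ - ∑ j k, T j i j k k`. -/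
def contractK : (Fin n → Elastic2 𝕜 n) →L[𝕜] Tensor1 𝕜 n :=
  LinearMap.toContinuousLinearMap
    { toFun := fun T i => -∑ j, ∑ k, (T j).1 i j k k
      map_add' := fun S T => by
        ext i
        simp [Finset.sum_add_distrib, add_comm]
      map_smul' := fun c T => by
        ext i
        simp [Finset.mul_sum] }

/-- The formal `L²` adjoint of `K`: `(K* f)_i = - ∑ j k, ∂_j f_{ijkk}`. -/
def Kstar : 𝓢(Euc n, Elastic2 𝕜 n) →L[𝕜] 𝓢(Euc n, Tensor1 𝕜 n) :=
  SchwartzMap.postcompCLM (contractK 𝕜 n) ∘L D 𝕜 n (Elastic2 𝕜 n)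

variable {n}

/-- The set of polarizations `ℝ v ∪ v^⊥` belonging to a direction `v`. -/
def polarizations (v : Euc n) : Set (Euc n) :=
  (Submodule.span ℝ {v} : Set (Euc n)) ∪ ((Submodule.span ℝ {v})ᗮ : Set (Euc n))

variable {𝕜}

/-- The contraction `∑ a_{ijkl} v_i q_j v_k q_l` of a tensor with `(v ⊗ q) ⊗ (v ⊗ q)`. -/
def contractVQ (v q : Euc n) (a : Tensor4 𝕜 n) : 𝕜 :=
  ∑ i, ∑ j, ∑ k, ∑ l, a i j k l * (v i : 𝕜) * (q j : 𝕜) * (v k : 𝕜) * (q l : 𝕜)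

/-- The integrals in the definition of the elastic X-ray transform converge absolutely. -/
theorem integrable_contractVQ (v : Metric.sphere (0 : Euc n) 1) (q : Euc n)
    (f : 𝓢(Euc n, Elastic2 𝕜 n)) (x : Euc n) :
    Integrable fun t : ℝ => contractVQ v.1 q (f (x + t • v.1)).1 := by
  have hv : ‖v.1‖ = 1 := by simp
  let g : 𝓢(ℝ, Elastic2 𝕜 n) :=
    SchwartzMap.compCLMOfAntilipschitz (g := fun t : ℝ => x + t • v.1) (K := 1) 𝕜 (by fun_prop)
      (AntilipschitzWith.of_le_mul_dist fun s t => by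
        simp [dist_eq_norm, ← sub_smul, norm_smul, hv]) f
  have key (i j k l : Fin n) : Integrable fun t : ℝ => (f (x + t • v.1)).1 i j k l := by
    let L : Elastic2 𝕜 n →L[𝕜] 𝕜 := LinearMap.toContinuousLinearMap
      { toFun := fun a => a.1 i j k l, map_add' := fun _ _ => rfl, map_smul' := fun _ _ => rfl }
    exact (SchwartzMap.postcompCLM L g).integrable
  unfold contractVQ
  refine integrable_finsetSum _ fun i _ => integrable_finsetSum _ fun j _ =>
    integrable_finsetSum _ fun k _ => integrable_finsetSum _ fun l _ => ?_
  exact ((((key i j k l).mul_const _).mul_const _).mul_const _).mul_const _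

variable (𝕜)

/-- The elastic X-ray transform of rank two in the direction `v` with polarization `q`:
`(X_{v,q} f)(x) = ∫ ∑ f_{ijkl}(x + t v) v_i q_j v_k q_l dt`. -/
def xray (v : Metric.sphere (0 : Euc n) 1) (q : Euc n) :
    𝓢(Euc n, Elastic2 𝕜 n) →ₗ[𝕜] (Euc n → 𝕜) where
  toFun f x := ∫ t : ℝ, contractVQ v.1 q (f (x + t • v.1)).1
  map_add' f g := by
    funext x
    rw [Pi.add_apply, ← integral_add (integrable_contractVQ v q f x)
      (integrable_contractVQ v q g x)]
    congr 1
    funext t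
    simp [contractVQ, add_mul, Finset.sum_add_distrib]
  map_smul' c f := by
    funext x
    rw [RingHom.id_apply, Pi.smul_apply, ← integral_smul]
    congr 1
    funext t
    simp [contractVQ, Finset.mul_sum, mul_assoc]

variable (n)

/-- The kernel of the elastic X-ray transform of rank two: the fields whose transform vanishes for
all directions and all polarizations belonging to them. -/
def kerXray : Submodule 𝕜 𝓢(Euc n, Elastic2 𝕜 n) :=
  ⨅ (v : Metric.sphere (0 : Euc n) 1) (q ∈ polarizations v.1), LinearMap.ker (xray 𝕜 v q)

end ElasticXRay

end

/-! Inclusion. Contracting `ε(T)` with `v ⊗ q ⊗ v ⊗ q` averages four contractions of `T`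
(`contract4_elasticSymm`). For `T = D²h`, each of them carries one derivative along `v`
(`contract4_D_D`), so the integrand is a total derivative along the line and integrates to zero,
whatever `q` is. For `T = DW ⊗ I`, each of them carries the factor `⟪v, q⟫`
(`contract4_tensorId_D`), which kills it if `q ⊥ v`; if `q = s • v`, what remains is `s²` times the
derivative along `v` of the `v`-component of `W`.

Trivial intersection. The Fourier transform turns the three conditions into linear algebra at each
frequency `ξ ≠ 0`. Let `A` be the quadrilinear form of the transformed tensor and `e = ξ / ‖ξ‖`. The
Fourier slice principle gives `A v q v q = 0` for `v ⊥ e` and `q` in `ℝ v ∪ v^⊥`; `H* f = 0` gives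
`A x y e e = 0`; `K* f = 0` gives `∑ k, A u e (b k) (b k) = 0`. The core is `elastic_eq_zero`: these
force `A = 0`.

On `e^⊥`, the longitudinal data determine only the totally symmetric part of `A`, and the transverse
data supply the rest (`elastic_eq_zero_of_polarizations`). Entries with a single `e` are seen
through `q = w + e`. For a unit `u ⊥ e`, these data leave one unknown: the quadratic form `w ↦ A w w
u e` is a multiple of the squared length of the projection of `w` to `e^⊥`. The trace condition from
`K*` kills that multiple, and the condition from `H*` handles entries with a further `e`. Thus the
transform of `f` vanishes off the origin, hence everywhere by continuity, and `f = 0`. -/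

namespace ElasticXRay

/-! ### Linear algebra of elastic quadrilinear forms at a fixed frequency -/

section Algebra

open scoped RealInnerProductSpace

variable {V W : Type*} [NormedAddCommGroup V] [InnerProductSpace ℝ V] [AddCommGroup W] [Module ℝ W]
  {A : V →ₗ[ℝ] V →ₗ[ℝ] V →ₗ[ℝ] V →ₗ[ℝ] W}

/-- An elastic quadrilinear form on a subspace vanishes if `A v v v v = 0` for all `v` and
`A v w v w = 0` for all orthogonal `v`, `w`. -/
theorem elastic_eq_zero_of_polarizations (p : Submodule ℝ V)
    (s1 : ∀ x y z w, A x y z w = A y x z w) (s2 : ∀ x y z w, A x y z w = A z w x y)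
    (h0 : ∀ v ∈ p, A v v v v = 0)
    (h1 : ∀ v ∈ p, ∀ w ∈ p, ⟪v, w⟫ = 0 → A v w v w = 0) :
    ∀ x ∈ p, ∀ y ∈ p, ∀ z ∈ p, ∀ w ∈ p, A x y z w = 0 := by
  have s3 (x y z w) : A x y z w = A x y w z := by rw [s2, s1, s2]
  have quartic (v) (hv : v ∈ p) (w) (hw : w ∈ p) :
      A v v v w = 0 ∧ (2 : ℝ) • A v w v w + A v v w w = 0 := by
    have e1 : A v v w v = A v v v w := s3 _ _ _ _
    have e2 : A v w v v = A v v v w := s2 _ _ _ _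
    have e3 : A w v v v = A v v v w := by rw [s1, e2]
    have e4 : A v w w v = A v w v w := s3 _ _ _ _
    have e5 : A w v v w = A v w v w := s1 _ _ _ _
    have e6 : A w v w v = A v w v w := by rw [s1, e4]
    have e7 : A w w v v = A v v w w := s2 _ _ _ _
    have e8 : A w v w w = A v w w w := s1 _ _ _ _
    have e9 : A w w v w = A v w w w := s2 _ _ _ _
    have e10 : A w w w v = A v w w w := by rw [s3, e9]
    -- The quartic `A` at `v + t • w` has the coefficients `4 A v v v w`, `4 A v w v w + 2 A v v w
    -- w` and `4 A v w w w` at `t`, `t²` and `t³`, its end terms being zero. The values `t = 1, -1,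
    -- 2` separate them.
    have hp := h0 (v + w) (p.add_mem hv hw)
    have hm := h0 (v - w) (p.sub_mem hv hw)
    have h2 := h0 (v + (2 : ℝ) • w) (p.add_mem hv (p.smul_mem _ hw))
    simp only [map_add, map_sub, map_smul, LinearMap.add_apply, LinearMap.sub_apply,
      LinearMap.smul_apply, h0 v hv, h0 w hw, e1, e2, e3, e4, e5, e6, e7, e8, e9, e10]
      at hp hm h2
    constructor
    · linear_combination (norm := module) (1 / 4 : ℝ) • hp - (1 / 12 : ℝ) • hm - (1 / 24 : ℝ) • h2
    · linear_combination (norm := module) (1 / 4 : ℝ) • hp + (1 / 4 : ℝ) • hm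
  have hvw (v) (hv : v ∈ p) (w) (hw : w ∈ p) : A v w v w = 0 := by
    rcases eq_or_ne v 0 with rfl | hv0
    · simp
    have hn : ⟪v, v⟫ ≠ 0 := inner_self_ne_zero.mpr hv0
    set c : ℝ := ⟪v, w⟫ / ⟪v, v⟫ with hc
    -- Removing from `w` its component along `v` changes `A v w v w` only by multiples of `A v v v
    -- w` and `A v v v v`, both zero.
    have h := h1 v hv (w - c • v) (p.sub_mem hw (p.smul_mem _ hv)) (by
      rw [inner_sub_right, inner_smul_right, hc]; field_simp; ring)
    have e2 : A v w v v = A v v v w := s2 _ _ _ _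
    simpa [(quartic v hv w hw).1, h0 v hv, e2] using h
  have hvvww (v) (hv : v ∈ p) (w) (hw : w ∈ p) : A v v w w = 0 := by
    simpa [hvw v hv w hw] using (quartic v hv w hw).2
  have hvvzw (v) (hv : v ∈ p) (z) (hz : z ∈ p) (w) (hw : w ∈ p) : A v v z w = 0 := by
    have h := hvvww v hv (z + w) (p.add_mem hz hw)
    simp only [map_add, LinearMap.add_apply, hvvww v hv z hz, hvvww v hv w hw, s3 v v w z] at h
    linear_combination (norm := module) (1 / 2 : ℝ) • h
  intro x hx y hy z hz w hw
  have h := hvvzw (x + y) (p.add_mem hx hy) z hz w hw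
  simp only [map_add, LinearMap.add_apply, hvvzw x hx z hz w hw, hvvzw y hy z hz w hw,
    s1 y x z w] at h
  linear_combination (norm := module) (1 / 2 : ℝ) • h

/-- An elastic quadrilinear form that is annihilated by all polarizations belonging to directions
orthogonal to a unit vector `e`, and that satisfies the two gauge conditions with respect to `e`,
vanishes. -/
theorem elastic_eq_zero {ι : Type*} [Fintype ι] (b : OrthonormalBasis ι ℝ V)
    (s1 : ∀ x y z w, A x y z w = A y x z w) (s2 : ∀ x y z w, A x y z w = A z w x y)
    {e : V} (he : ‖e‖ = 1)
    (hlong : ∀ v, ⟪v, e⟫ = 0 → A v v v v = 0)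
    (htrans : ∀ v q, ⟪v, e⟫ = 0 → ⟪v, q⟫ = 0 → A v q v q = 0)
    (hH : ∀ x y, A x y e e = 0) (hK : ∀ u, ∑ k, A u e (b k) (b k) = 0) (x y z w : V) :
    A x y z w = 0 := by
  have s3 (x y z w) : A x y z w = A x y w z := by rw [s2, s1, s2]
  have hee : ⟪e, e⟫ = 1 := by rw [real_inner_self_eq_norm_sq, he, one_pow]
  let p : Submodule ℝ V := (ℝ ∙ e)ᗮ
  have hp (v : V) : v ∈ p ↔ ⟪v, e⟫ = 0 := by
    rw [Submodule.mem_orthogonal_singleton_iff_inner_left]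
  have hB := elastic_eq_zero_of_polarizations p s1 s2 (fun v hv => hlong v ((hp v).1 hv))
    fun v hv w _ hvw => htrans v w ((hp v).1 hv) hvw
  have hveve (v) (hv : v ∈ p) : A v e v e = 0 := htrans v e ((hp v).1 hv) ((hp v).1 hv)
  have hvewe (v) (hv : v ∈ p) (w) (hw : w ∈ p) : A v e w e = 0 := by
    have h := hveve (v + w) (p.add_mem hv hw)
    simp only [map_add, LinearMap.add_apply, hveve v hv, hveve w hw, s2 w e v e] at h
    linear_combination (norm := module) (1 / 2 : ℝ) • h
  have hc (v) (hv : v ∈ p) (w) (hw : w ∈ p) (hvw : ⟪v, w⟫ = 0) : A v w v e = 0 := by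
    -- Since `e ⊥ v` too, `w + e` is an admissible polarization; the cross term of the resulting
    -- square is `2 A v w v e`.
    have h := htrans v (w + e) ((hp v).1 hv) (by rw [inner_add_right, hvw, (hp v).1 hv, add_zero])
    simp only [map_add, LinearMap.add_apply, hveve v hv, htrans v w ((hp v).1 hv) hvw,
      s2 v e v w] at h
    linear_combination (norm := module) (1 / 2 : ℝ) • h
  have hlen (u) (hu : u ∈ p) (w) (hw : w ∈ p) (huw : ⟪u, w⟫ = 0) (hn : ⟪u, u⟫ = ⟪w, w⟫) :
      A w w u e = A u u u e := by
    -- Orthogonal vectors of equal length have orthogonal sum and difference. The two instances of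
    -- `hc` say that `A u u - A w w`, as a form in the last two slots, vanishes at `(u + w, e)` and
    -- `(u - w, e)`, hence at `(u, e)`.
    have h1 := hc (u + w) (p.add_mem hu hw) (u - w) (p.sub_mem hu hw) (by
      rw [inner_add_left, inner_sub_right, inner_sub_right, real_inner_comm u w, hn, huw]; ring)
    have h2 := hc (u - w) (p.sub_mem hu hw) (u + w) (p.add_mem hu hw) (by
      rw [inner_sub_left, inner_add_right, inner_add_right, real_inner_comm u w, hn, huw]; ring)
    simp only [map_add, map_sub, LinearMap.add_apply, LinearMap.sub_apply, s1 w u] at h1 h2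
    linear_combination (norm := module) (-1 / 2 : ℝ) • h1 - (1 / 2 : ℝ) • h2
  have dec (x : V) : x - ⟪x, e⟫ • e ∈ p := by
    rw [hp, inner_sub_left, inner_smul_left, hee]; simp
  have hunit (u) (hu : u ∈ p) (hun : ⟪u, u⟫ = 1) (w : V) : A w w u e = 0 := by
    have hue := (hp u).1 hu
    have heu : ⟪e, u⟫ = 0 := by rw [real_inner_comm, hue]
    have hQ (w : V) : ⟪w, u⟫ ^ 2 ≤ ⟪w, w⟫ - ⟪w, e⟫ ^ 2 ∧
        A w w u e = (⟪w, w⟫ - ⟪w, e⟫ ^ 2) • A u u u e := by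
      -- In the splitting of `w` into `r`, an `e`-part and a `u`-part, all cross terms of `A w w u
      -- e` vanish, as does the `e`-`e` term by `hH`; `hlen` gives the `r`-part.
      set r := w - ⟪w, e⟫ • e - ⟪w, u⟫ • u with hr
      have hrp : r ∈ p := p.sub_mem (dec w) (p.smul_mem _ hu)
      have hur : ⟪u, r⟫ = 0 := by
        rw [hr, inner_sub_right, inner_sub_right, inner_smul_right, inner_smul_right, hue, hun,
          real_inner_comm u w]
        ring
      have hrr : ⟪r, r⟫ = ⟪w, w⟫ - ⟪w, e⟫ ^ 2 - ⟪w, u⟫ ^ 2 := by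
        rw [hr]
        simp only [inner_sub_left, inner_sub_right, inner_smul_right, inner_smul_left, hee, hun,
          hue, heu, real_inner_comm w e, real_inner_comm w u, RCLike.conj_to_real]
        ring
      have hrru : A r r u e = ⟪r, r⟫ • A u u u e := by
        have h := hlen (‖r‖ • u) (p.smul_mem _ hu) r hrp
          (by rw [inner_smul_left, hur, mul_zero])
          (by rw [inner_smul_left, inner_smul_right, hun, real_inner_self_eq_norm_sq]; simp; ring)
        rcases eq_or_ne r 0 with h0 | h0
        · simp [h0]
        have hn : ‖r‖ ≠ 0 := norm_ne_zero_iff.mpr h0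
        simp only [map_smul, LinearMap.smul_apply, smul_smul] at h
        rw [real_inner_self_eq_norm_sq]
        have := congrArg (fun t => ‖r‖⁻¹ • t) h
        simp only [smul_smul, inv_mul_cancel₀ hn, one_smul] at this
        rw [this]
        congr 1
        field_simp
      have e1 : A r e u e = 0 := hvewe r hrp u hu
      have e2 : A e r u e = 0 := by rw [s1, e1]
      have e3 : A u e u e = 0 := hvewe u hu u hu
      have e4 : A e u u e = 0 := by rw [s1, e3]
      have e5 : A u r u e = 0 := hc u hu r hrp hur
      have e6 : A r u u e = 0 := by rw [s1, e5]
      have e7 : A e e u e = 0 := by rw [s2, hH]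
      have hw : w = r + ⟪w, e⟫ • e + ⟪w, u⟫ • u := by rw [hr]; abel
      have : A w w u e = ⟪r, r⟫ • A u u u e + (⟪w, u⟫ ^ 2) • A u u u e := by
        conv_lhs => rw [hw]
        simp only [map_add, map_smul, LinearMap.add_apply, LinearMap.smul_apply, e1, e2, e3, e4,
          e5, e6, e7, hrru]
        module
      refine ⟨by linarith [real_inner_self_nonneg (x := r)], ?_⟩
      rw [this, hrr]
      module
    -- The trace of the projection to `e^⊥` only has to be nonzero. It is at least `∑ k, ⟪b k, u⟫²`,
    -- which is `1` by Parseval, so the dimension need not be computed.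
    have hle : 1 ≤ ∑ k, (⟪b k, b k⟫ - ⟪b k, e⟫ ^ 2) := by
      have := b.sum_sq_norm_inner_right u
      rw [← real_inner_self_eq_norm_sq, hun] at this
      rw [← this]
      refine Finset.sum_le_sum fun k _ => ?_
      rw [Real.norm_eq_abs, sq_abs]
      exact (hQ (b k)).1
    have huuu : A u u u e = 0 := by
      have hs := hK u
      rw [Finset.sum_congr rfl fun k _ => (s2 u e (b k) (b k)).trans (hQ (b k)).2,
        ← Finset.sum_smul] at hs
      exact (smul_eq_zero.1 hs).resolve_left (by linarith)
    rw [(hQ w).2, huuu, smul_zero]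
  have hwwu (u) (hu : u ∈ p) (w : V) : A w w u e = 0 := by
    rcases eq_or_ne u 0 with rfl | h0
    · simp
    have hn : ‖u‖ ≠ 0 := norm_ne_zero_iff.mpr h0
    have h := hunit (‖u‖⁻¹ • u) (p.smul_mem _ hu)
      (by rw [real_inner_self_eq_norm_sq, norm_smul, norm_inv, norm_norm, inv_mul_cancel₀ hn,
        one_pow]) w
    rw [map_smul, LinearMap.smul_apply] at h
    exact (smul_eq_zero.1 h).resolve_left (inv_ne_zero hn)
  have hxyu (x y u : V) (hu : u ∈ p) : A x y u e = 0 := by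
    have h := hwwu u hu (x + y)
    simp only [map_add, LinearMap.add_apply, hwwu u hu x, hwwu u hu y, s1 y x] at h
    linear_combination (norm := module) (1 / 2 : ℝ) • h
  have hxyze (x y z : V) : A x y z e = 0 := by
    rw [← sub_add_cancel z (⟪z, e⟫ • e)]
    simp only [map_add, map_smul, LinearMap.add_apply, LinearMap.smul_apply, hH,
      hxyu _ _ _ (dec z), smul_zero, add_zero]
  have hxyez (x y z : V) : A x y e z = 0 := by rw [s3, hxyze]
  have hxeyz (x y z : V) : A x e y z = 0 := by rw [s2, hxyze]
  have hexyz (x y z : V) : A e x y z = 0 := by rw [s2, hxyez]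
  rw [← sub_add_cancel x (⟪x, e⟫ • e), ← sub_add_cancel y (⟪y, e⟫ • e),
    ← sub_add_cancel z (⟪z, e⟫ • e), ← sub_add_cancel w (⟪w, e⟫ • e)]
  simp only [map_add _ (_ - _), map_smul, LinearMap.add_apply, LinearMap.smul_apply, hxyze, hxyez,
    hxeyz, hexyz, smul_zero, add_zero]
  exact hB _ (dec x) _ (dec y) _ (dec z) _ (dec w)

end Algebra

end ElasticXRay

namespace ElasticXRay

/-! ### Integration along lines and the Fourier slice principle -/

section Lines

open scoped RealInnerProductSpace FourierTransform LineDeriv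

variable {V : Type*} [NormedAddCommGroup V] [InnerProductSpace ℝ V]

/-- The restriction of a Schwartz function to a line is a Schwartz function. -/
theorem exists_schwartz_restrict_line {E : Type*} [NormedAddCommGroup E] [NormedSpace ℝ E]
    (f : 𝓢(V, E)) (x : V) {v : V} (hv : ‖v‖ = 1) :
    ∃ g : 𝓢(ℝ, E), ∀ t, g t = f (x + t • v) :=
  ⟨SchwartzMap.compCLMOfAntilipschitz (g := fun t : ℝ => x + t • v) (K := 1) ℝ (by fun_prop)
      (AntilipschitzWith.of_le_mul_dist fun s t => by
        simp [dist_eq_norm, ← sub_smul, norm_smul, hv]) f, fun _ => rfl⟩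

/-- The integral of a directional derivative along a line in the same direction vanishes. -/
theorem integral_line_lineDeriv {E : Type*} [NormedAddCommGroup E] [NormedSpace ℝ E]
    (f : 𝓢(V, E)) (x : V) {v : V} (hv : ‖v‖ = 1) :
    ∫ t : ℝ, ∂_{v} f (x + t • v) = 0 := by
  obtain ⟨g, hg⟩ := exists_schwartz_restrict_line f x hv
  obtain ⟨g', hg'⟩ := exists_schwartz_restrict_line (∂_{v} f) x hv
  have h (t : ℝ) : HasDerivAt g (g' t) t := by
    rw [hg', SchwartzMap.lineDerivOp_apply_eq_fderiv]
    have h1 : HasDerivAt (fun t : ℝ => x + t • v) v t := by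
      simpa using ((hasDerivAt_id t).smul_const v).const_add x
    exact ((f.hasFDerivAt (x + t • v)).comp_hasDerivAt t h1).congr_of_eventuallyEq
      (.of_forall hg)
  simp only [← hg']
  exact integral_eq_zero_of_hasDerivAt_of_integrable h g'.integrable g.integrable

variable [FiniteDimensional ℝ V] [MeasurableSpace V] [BorelSpace V]

/-- The map is a composite of two shears and swaps; `‖v‖ = 1` makes the second component `t + ⟪x - t
• v, v⟫` collapse to `⟪x, v⟫`. It permits Fubini along `v` without splitting `V` as `ℝ v ⊕ v^⊥`. -/
theorem measurePreserving_lineShear {v : V} (hv : ‖v‖ = 1) :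
    MeasurePreserving (fun z : V × ℝ => (z.1 - z.2 • v, ⟪z.1, v⟫)) := by
  have h1 : MeasurePreserving (fun z : ℝ × V => (z.1, z.2 - z.1 • v)) :=
    (MeasurePreserving.id volume).skew_product (by fun_prop)
      (.of_forall fun t => map_sub_right_eq_self volume (t • v))
  have h2 : MeasurePreserving (fun z : V × ℝ => (z.1, z.2 + ⟪z.1, v⟫)) :=
    (MeasurePreserving.id volume).skew_product (by fun_prop)
      (.of_forall fun x => map_add_right_eq_self volume ⟪x, v⟫)
  convert (h2.comp Measure.measurePreserving_swap).comp
    (h1.comp Measure.measurePreserving_swap) using 1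
  · funext z
    simp [inner_sub_left, inner_smul_left, hv]
  · exact Measure.volume_eq_prod _ _

/-- A function whose integrals over all lines in a given direction vanish has integral zero. -/
theorem integral_eq_zero_of_integral_line_eq_zero {F : V → ℂ} (hF : Integrable F) {v : V}
    (hv : ‖v‖ = 1) (h : ∀ x, ∫ t : ℝ, F (x + t • v) = 0) : ∫ x, F x = 0 := by
  -- An auxiliary factor of integral one adds a real variable. After the shear `ψ` depends on `x`
  -- alone, so the integral over `t` is a line integral of `F`.
  let ψ : ℝ → ℂ := (Set.Icc 0 1).indicator fun _ => 1
  have hψ : Integrable ψ := (integrable_indicator_iff measurableSet_Icc).2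
    (integrableOn_const (by simp))
  have hψ1 : ∫ t, ψ t = 1 := by simp [ψ, integral_indicator measurableSet_Icc]
  have hG := hF.mul_prod hψ
  have hS := measurePreserving_lineShear hv
  calc ∫ x, F x = ∫ z : V × ℝ, F z.1 * ψ z.2 := by
        rw [Measure.volume_eq_prod, integral_prod_mul, hψ1, mul_one]
    _ = ∫ z : V × ℝ, F (z.1 - z.2 • v) * ψ ⟪z.1, v⟫ := by
        conv_lhs => rw [← hS.map_eq]
        rw [integral_map hS.measurable.aemeasurable (by rw [hS.map_eq]; exact hG.1)]
    _ = ∫ x, ∫ t : ℝ, F (x - t • v) * ψ ⟪x, v⟫ :=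
        integral_prod _ (hS.integrable_comp_of_integrable hG)
    _ = 0 := by
        refine integral_eq_zero_of_ae (.of_forall fun x => ?_)
        have := h x
        rw [← integral_neg_eq_self] at this
        simp only [neg_smul, ← sub_eq_add_neg] at this
        simp [integral_mul_const, this]

/-- The Fourier slice principle: if the integrals of `g` over all lines in the direction `v` vanish,
then the Fourier transform of `g` vanishes on the hyperplane orthogonal to `v`. -/
theorem fourier_eq_zero_of_integral_line_eq_zero (g : 𝓢(V, ℂ)) {v ξ : V} (hv : ‖v‖ = 1)
    (hξ : ⟪v, ξ⟫ = 0) (h : ∀ x, ∫ t : ℝ, g (x + t • v) = 0) : 𝓕 g ξ = 0 := by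
  rw [SchwartzMap.fourier_coe, Real.fourier_eq]
  refine integral_eq_zero_of_integral_line_eq_zero
    ((Real.fourierIntegral_convergent_iff ξ).2 g.integrable) hv fun x => ?_
  -- The Fourier character is constant along `v` because `v ⊥ ξ`, so it leaves the line integral.
  simp only [inner_add_left, inner_smul_left, hξ, mul_zero, add_zero, Circle.smul_def, smul_eq_mul]
  rw [integral_const_mul, h, mul_zero]

theorem fourier_lineDeriv_apply (g : 𝓢(V, ℂ)) (m ξ : V) :
    𝓕 (∂_{m} g) ξ = (2 * Real.pi * Complex.I * ⟪ξ, m⟫) * 𝓕 g ξ := by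
  rw [SchwartzMap.fourier_lineDerivOp_eq]
  have : (inner ℝ · m : V → ℝ).HasTemperateGrowth := ((innerSL ℝ).flip m).hasTemperateGrowth
  simp [SchwartzMap.smulLeftCLM_apply_apply this, mul_assoc]

end Lines

end ElasticXRay

noncomputable section

namespace ElasticXRay

open scoped RealInnerProductSpace FourierTransform LineDeriv

/-! ### Quadrilinear forms of rank four tensors -/

section Contraction

variable {𝕜 : Type*} [RCLike 𝕜] {n : ℕ}

/-- The quadrilinear form `∑ a_{ijkl} x_i y_j z_k w_l` of a rank four tensor. -/
def contract4 (a : Tensor4 𝕜 n) :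
    Euc n →ₗ[ℝ] Euc n →ₗ[ℝ] Euc n →ₗ[ℝ] Euc n →ₗ[ℝ] 𝕜 :=
  ∑ i, ∑ j, ∑ k, ∑ l, (EuclideanSpace.projₗ i).smulRight ((EuclideanSpace.projₗ j).smulRight
    ((EuclideanSpace.projₗ k).smulRight ((EuclideanSpace.projₗ l).smulRight (a i j k l))))

theorem contract4_apply (a : Tensor4 𝕜 n) (x y z w : Euc n) :
    contract4 a x y z w =
      ∑ i, ∑ j, ∑ k, ∑ l, a i j k l * (x i : 𝕜) * (y j : 𝕜) * (z k : 𝕜) * (w l : 𝕜) := by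
  simp only [contract4, LinearMap.sum_apply, LinearMap.smulRight_apply, LinearMap.smul_apply,
    EuclideanSpace.projₗ, PiLp.projₗ_apply, RCLike.real_smul_eq_coe_mul]
  refine Finset.sum_congr rfl fun i _ => Finset.sum_congr rfl fun j _ =>
    Finset.sum_congr rfl fun k _ => Finset.sum_congr rfl fun l _ => ?_
  ring

theorem contractVQ_eq_contract4 (v q : Euc n) (a : Tensor4 𝕜 n) :
    contractVQ v q a = contract4 a v q v q :=
  (contract4_apply a v q v q).symm

theorem contract4_swap_left (a : Tensor4 𝕜 n) (x y z w : Euc n) :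
    contract4 (fun i j k l => a j i k l) x y z w = contract4 a y x z w := by
  simp only [contract4_apply]
  rw [Finset.sum_comm]
  refine Finset.sum_congr rfl fun i _ => Finset.sum_congr rfl fun j _ =>
    Finset.sum_congr rfl fun k _ => Finset.sum_congr rfl fun l _ => ?_
  ring

theorem contract4_swap_right (a : Tensor4 𝕜 n) (x y z w : Euc n) :
    contract4 (fun i j k l => a i j l k) x y z w = contract4 a x y w z := by
  simp only [contract4_apply]
  refine Finset.sum_congr rfl fun i _ => Finset.sum_congr rfl fun j _ => ?_
  rw [Finset.sum_comm]
  refine Finset.sum_congr rfl fun k _ => Finset.sum_congr rfl fun l _ => ?_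
  ring

theorem contract4_swap_pairs (a : Tensor4 𝕜 n) (x y z w : Euc n) :
    contract4 (fun i j k l => a k l i j) x y z w = contract4 a z w x y := by
  have comm (f : Fin n → Fin n → Fin n → Fin n → 𝕜) :
      ∑ i, ∑ j, ∑ k, ∑ l, f i j k l = ∑ k, ∑ l, ∑ i, ∑ j, f i j k l := by
    have h := Finset.sum_comm (s := Finset.univ) (t := Finset.univ)
      (f := fun p r : Fin n × Fin n => f p.1 p.2 r.1 r.2)
    simpa only [Fintype.sum_prod_type] using h
  simp only [contract4_apply]
  rw [comm]
  refine Finset.sum_congr rfl fun i _ => Finset.sum_congr rfl fun j _ =>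
    Finset.sum_congr rfl fun k _ => Finset.sum_congr rfl fun l _ => ?_
  ring

/-- Exchanging the index pairs fixes `v ⊗ q ⊗ v ⊗ q` and only permutes its images under the swaps
within pairs, so the eight terms coincide two by two. -/
theorem contract4_elasticSymm (T : Tensor4 𝕜 n) (v q : Euc n) :
    contract4 (elasticSymm 𝕜 n T).1 v q v q = (1 / 4 : 𝕜) *
      (contract4 T v q v q + contract4 T q v v q + contract4 T v q q v + contract4 T q v q v) := by
  have h : contract4 (elasticSymm 𝕜 n T).1 v q v q = (1 / 8 : 𝕜) *
      (contract4 T v q v q + contract4 (fun i j k l => T j i k l) v q v q +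
        contract4 (fun i j k l => T i j l k) v q v q +
        contract4 (fun i j k l => T j i l k) v q v q +
        contract4 (fun i j k l => T k l i j) v q v q +
        contract4 (fun i j k l => T l k i j) v q v q +
        contract4 (fun i j k l => T k l j i) v q v q +
        contract4 (fun i j k l => T l k j i) v q v q) := by
    simp only [contract4_apply, ← Finset.sum_add_distrib, Finset.mul_sum]
    refine Finset.sum_congr rfl fun i _ => Finset.sum_congr rfl fun j _ =>
      Finset.sum_congr rfl fun k _ => Finset.sum_congr rfl fun l _ => ?_
    simp only [elasticSymm, LinearMap.coe_toContinuousLinearMap', LinearMap.coe_mk, AddHom.coe_mk]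
    ring
  rw [h, contract4_swap_left T, contract4_swap_right T,
    contract4_swap_left (fun i j k l => T i j l k), contract4_swap_right T,
    contract4_swap_pairs T, contract4_swap_pairs (fun i j k l => T j i k l), contract4_swap_left T,
    contract4_swap_pairs (fun i j k l => T i j l k), contract4_swap_right T,
    contract4_swap_pairs (fun i j k l => T j i l k),
    contract4_swap_left (fun i j k l => T i j l k), contract4_swap_right T]
  ring

end Contraction

/-! ### Contracted derivatives and the inclusion of the ranges in the kernel -/

section Derivatives

variable {V E : Type*} [NormedAddCommGroup V] [NormedSpace ℝ V] [NormedAddCommGroup E]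
  [NormedSpace ℝ E]

theorem lineDeriv_comm (g : 𝓢(V, E)) (a b : V) : ∂_{a} (∂_{b} g) = ∂_{b} (∂_{a} g) := by
  have key (a b x) : (∂_{a} (∂_{b} g) : 𝓢(V, E)) x = fderiv ℝ (fderiv ℝ g) x a b := by
    have h : ⇑(∂_{b} g : 𝓢(V, E)) = fun y => fderiv ℝ g y b := by
      funext y
      exact SchwartzMap.lineDerivOp_apply_eq_fderiv _ _ _
    rw [SchwartzMap.lineDerivOp_apply_eq_fderiv, h]
    have hd : DifferentiableAt ℝ (fderiv ℝ g) x :=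
      ((g.smooth 2).fderiv_right (m := 1) (by norm_num)).differentiable (by norm_num) x
    rw [(hd.hasFDerivAt.clm_apply (hasFDerivAt_const b x)).fderiv]
    simp
  ext x
  rw [key, key]
  exact ((g.smooth 2).contDiffAt.isSymmSndFDerivAt (by simp)) a b

theorem lineDeriv_eq_sum {n : ℕ} (g : 𝓢(Euc n, E)) (a : Euc n) :
    ∂_{a} g = ∑ i, a i • ∂_{EuclideanSpace.single i (1 : ℝ)} g := by
  have h := (EuclideanSpace.basisFun (Fin n) ℝ).sum_repr a
  simp only [EuclideanSpace.basisFun_repr, EuclideanSpace.basisFun_apply] at h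
  conv_lhs => rw [← h]
  rw [LineDeriv.lineDerivOp_left_sum]
  simp only [LineDeriv.lineDerivOp_left_smul]

variable (𝕜 : Type*) [RCLike 𝕜] {n : ℕ} {F : Type*} [NormedAddCommGroup F] [NormedSpace ℝ F]
  [NormedSpace 𝕜 F] [SMulCommClass ℝ 𝕜 F]

theorem D_apply (f : 𝓢(Euc n, F)) (L : F →L[ℝ] E) (j : Fin n) (x : Euc n) :
    L (D 𝕜 n F f x j) =
      ∂_{EuclideanSpace.single j (1 : ℝ)} (SchwartzMap.postcompCLM (𝕜 := ℝ) L f) x := by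
  rw [SchwartzMap.lineDerivOp_apply_eq_fderiv]
  change L (fderiv ℝ f x _) = fderiv ℝ (L ∘ f) x _
  rw [fderiv_comp x L.differentiableAt f.differentiableAt, L.fderiv]
  rfl

theorem D_D_apply (f : 𝓢(Euc n, F)) (L : F →L[ℝ] E) (k l : Fin n) (x : Euc n) :
    L (D 𝕜 n (Fin n → F) (D 𝕜 n F f) x k l) =
      ∂_{EuclideanSpace.single k (1 : ℝ)} (∂_{EuclideanSpace.single l (1 : ℝ)}
        (SchwartzMap.postcompCLM (𝕜 := ℝ) L f)) x := by
  have h := D_apply 𝕜 (D 𝕜 n F f) (L ∘L ContinuousLinearMap.proj l) k x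
  have h2 : SchwartzMap.postcompCLM (𝕜 := ℝ) (L ∘L ContinuousLinearMap.proj l) (D 𝕜 n F f) =
      ∂_{EuclideanSpace.single l (1 : ℝ)} (SchwartzMap.postcompCLM (𝕜 := ℝ) L f) := by
    ext y
    exact D_apply 𝕜 f L l y
  rw [h2] at h
  exact h

/-- The contraction of a rank two tensor with two vectors. -/
def contract2 (c d : Euc n) : Tensor2 𝕜 n →L[ℝ] 𝕜 :=
  ∑ k, ∑ l, (c k * d l) • (ContinuousLinearMap.proj (R := ℝ) (φ := fun _ : Fin n => 𝕜) l ∘L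
    ContinuousLinearMap.proj (R := ℝ) (φ := fun _ : Fin n => Fin n → 𝕜) k)

theorem contract2_apply (c d : Euc n) (a : Tensor2 𝕜 n) :
    contract2 𝕜 c d a = ∑ k, ∑ l, a k l * (c k : 𝕜) * (d l : 𝕜) := by
  simp only [contract2, sum_apply, smul_apply,
    ContinuousLinearMap.comp_apply, ContinuousLinearMap.proj_apply, RCLike.real_smul_eq_coe_mul]
  refine Finset.sum_congr rfl fun k _ => Finset.sum_congr rfl fun l _ => ?_
  push_cast
  ring

/-- The contraction of a vector with a vector. -/
def contract1 (c : Euc n) : Tensor1 𝕜 n →L[ℝ] 𝕜 :=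
  ∑ k, c k • ContinuousLinearMap.proj (R := ℝ) (φ := fun _ : Fin n => 𝕜) k

theorem contract1_apply (c : Euc n) (a : Tensor1 𝕜 n) :
    contract1 𝕜 c a = ∑ k, a k * (c k : 𝕜) := by
  simp only [contract1, sum_apply, smul_apply,
    ContinuousLinearMap.proj_apply, RCLike.real_smul_eq_coe_mul, mul_comm]

theorem contract4_D_D (h : 𝓢(Euc n, Tensor2 𝕜 n)) (a b c d x : Euc n) :
    contract4 (D 𝕜 n (Fin n → Tensor2 𝕜 n) (D 𝕜 n (Tensor2 𝕜 n) h) x) a b c d =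
      ∂_{a} (∂_{b} (SchwartzMap.postcompCLM (𝕜 := ℝ) (contract2 𝕜 c d) h)) x := by
  rw [lineDeriv_eq_sum _ b, LineDeriv.lineDerivOp_sum, sum_apply, contract4_apply,
    Finset.sum_comm]
  refine Finset.sum_congr rfl fun j _ => ?_
  rw [LineDeriv.lineDerivOp_smul, smul_apply, lineDeriv_eq_sum _ a,
    sum_apply, Finset.smul_sum]
  refine Finset.sum_congr rfl fun i _ => ?_
  rw [smul_apply, ← D_D_apply 𝕜 h, contract2_apply, RCLike.real_smul_eq_coe_mul,
    RCLike.real_smul_eq_coe_mul, Finset.mul_sum, Finset.mul_sum]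
  refine Finset.sum_congr rfl fun k _ => ?_
  rw [Finset.mul_sum, Finset.mul_sum]
  refine Finset.sum_congr rfl fun l _ => ?_
  ring

theorem contract4_tensorId_D (W : 𝓢(Euc n, Tensor1 𝕜 n)) (a b c d x : Euc n) :
    contract4 (tensorId 𝕜 n (D 𝕜 n (Tensor1 𝕜 n) W x)) a b c d =
      (⟪c, d⟫ : ℝ) • ∂_{a} (SchwartzMap.postcompCLM (𝕜 := ℝ) (contract1 𝕜 b) W) x := by
  rw [lineDeriv_eq_sum _ a, sum_apply, contract4_apply, Finset.smul_sum]
  refine Finset.sum_congr rfl fun i _ => ?_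
  rw [smul_apply, ← D_apply 𝕜 W, contract1_apply, Finset.smul_sum, Finset.smul_sum]
  refine Finset.sum_congr rfl fun j _ => ?_
  rw [PiLp.inner_apply, Finset.sum_smul]
  refine Finset.sum_congr rfl fun k _ => ?_
  simp only [tensorId, LinearMap.coe_toContinuousLinearMap', LinearMap.coe_mk, AddHom.coe_mk,
    Matrix.one_apply, mul_ite, ite_mul, mul_zero, zero_mul, mul_one, Finset.sum_ite_eq,
    Finset.mem_univ, if_true, RCLike.real_smul_eq_coe_mul]
  simp only [RCLike.inner_apply, conj_trivial]
  push_cast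
  ring

theorem mem_kerXray {f : 𝓢(Euc n, Elastic2 𝕜 n)} :
    f ∈ kerXray 𝕜 n ↔ ∀ v : Euc n, ‖v‖ = 1 → ∀ q ∈ polarizations v, ∀ x,
      ∫ t : ℝ, contract4 (f (x + t • v)).1 v q v q = 0 := by
  simp only [kerXray, Submodule.mem_iInf, LinearMap.mem_ker, funext_iff, Subtype.forall,
    mem_sphere_zero_iff_norm, xray, LinearMap.coe_mk, AddHom.coe_mk, contractVQ_eq_contract4,
    Pi.zero_apply]

theorem range_H_le_kerXray : LinearMap.range (H 𝕜 n).toLinearMap ≤ kerXray 𝕜 n := by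
  rintro _ ⟨h, rfl⟩
  refine mem_kerXray 𝕜 |>.2 fun v hv q _ x => ?_
  set h' := SchwartzMap.postcompCLM (Elastic1 𝕜 n).subtypeL h with hh'
  let g (c d : Euc n) : 𝓢(Euc n, 𝕜) := SchwartzMap.postcompCLM (𝕜 := ℝ) (contract2 𝕜 c d) h'
  have key (y : Euc n) : contract4 (H 𝕜 n h y).1 v q v q =
      (1 / 2 : 𝕜) * ∂_{v} (∂_{q} (g v q) + ∂_{q} (g q v)) y := by
    change contract4 (elasticSymm 𝕜 n
      (D 𝕜 n (Fin n → Tensor2 𝕜 n) (D 𝕜 n (Tensor2 𝕜 n) h') y)).1 v q v q = _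
    rw [contract4_elasticSymm]
    simp only [contract4_D_D]
    -- Commuting the derivatives puts `∂_{v}` outermost in all four terms, so that their sum is a
    -- derivative along the line.
    rw [lineDeriv_comm _ q v, lineDeriv_comm _ q v, LineDeriv.lineDerivOp_add,
      add_apply]
    ring
  change ∫ t : ℝ, contract4 (H 𝕜 n h (x + t • v)).1 v q v q = 0
  simp only [key]
  rw [integral_const_mul, integral_line_lineDeriv _ _ hv, mul_zero]

theorem range_K_le_kerXray : LinearMap.range (K 𝕜 n).toLinearMap ≤ kerXray 𝕜 n := by
  rintro _ ⟨W, rfl⟩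
  refine mem_kerXray 𝕜 |>.2 fun v hv q hq x => ?_
  change ∫ t : ℝ, contract4 (elasticSymm 𝕜 n (tensorId 𝕜 n
    (D 𝕜 n (Tensor1 𝕜 n) W (x + t • v)))).1 v q v q = 0
  rcases hq with hq | hq
  · obtain ⟨s, rfl⟩ := Submodule.mem_span_singleton.1 hq
    have key (y : Euc n) : contract4 (elasticSymm 𝕜 n (tensorId 𝕜 n
        (D 𝕜 n (Tensor1 𝕜 n) W y))).1 v (s • v) v (s • v) =
          (s ^ 2) • ∂_{v} (SchwartzMap.postcompCLM (𝕜 := ℝ) (contract1 𝕜 v) W) y := by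
      simp only [map_smul, LinearMap.smul_apply, contract4_elasticSymm, contract4_tensorId_D,
        real_inner_self_eq_norm_sq, hv, RCLike.real_smul_eq_coe_mul]
      push_cast
      ring
    simp only [key]
    rw [integral_smul, integral_line_lineDeriv _ _ hv, smul_zero]
  · have h : ⟪v, q⟫ = 0 := Submodule.mem_orthogonal_singleton_iff_inner_right.1 hq
    simp [contract4_elasticSymm, contract4_tensorId_D, h, real_inner_comm v q]

end Derivatives

end ElasticXRay

end

noncomputable section

namespace ElasticXRay

open scoped RealInnerProductSpace FourierTransform LineDeriv

/-! ### Fourier transform of the gauge conditions and triviality of the intersection -/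

section Gauge

variable {𝕜 : Type*} [RCLike 𝕜] {n : ℕ}

set_option synthInstance.maxHeartbeats 400000 in
instance : SMulCommClass ℝ 𝕜 (Elastic2 𝕜 n) := inferInstance

/-- A component of an elastic `2`-tensor, as a complex number. -/
def complexCoord (i j k l : Fin n) : Elastic2 𝕜 n →L[ℝ] ℂ where
  toFun a := RCLike.map 𝕜 ℂ (a.1 i j k l)
  map_add' _ _ := map_add (RCLike.map 𝕜 ℂ) _ _
  map_smul' _ _ := map_smul (RCLike.map 𝕜 ℂ) _ _
  cont := (RCLike.map 𝕜 ℂ).continuous.comp <| (continuous_apply l).comp <| (continuous_apply k).comp <|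
    (continuous_apply j).comp <| (continuous_apply i).comp continuous_subtype_val

/-- A component of a Schwartz elastic `2`-tensor field, as a complex Schwartz function. -/
def component (f : 𝓢(Euc n, Elastic2 𝕜 n)) (i j k l : Fin n) : 𝓢(Euc n, ℂ) :=
  SchwartzMap.postcompCLM (𝕜 := ℝ) (complexCoord i j k l) f

theorem component_apply (f : 𝓢(Euc n, Elastic2 𝕜 n)) (i j k l : Fin n) (x : Euc n) :
    component f i j k l x = RCLike.map 𝕜 ℂ ((f x).1 i j k l) := rfl

/-- The Fourier transform of a Schwartz elastic `2`-tensor field. -/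
def fourierTensor (f : 𝓢(Euc n, Elastic2 𝕜 n)) (ξ : Euc n) : Tensor4 ℂ n :=
  fun i j k l => 𝓕 (component f i j k l) ξ

theorem fourierTensor_swap (f : 𝓢(Euc n, Elastic2 𝕜 n)) (ξ : Euc n) (i j k l : Fin n) :
    fourierTensor f ξ i j k l = fourierTensor f ξ j i k l := by
  have h : component f i j k l = component f j i k l := by
    ext x
    rw [component_apply, component_apply, ((f x).2 i j k l).1]
  simp only [fourierTensor, h]

theorem fourierTensor_swap_pairs (f : 𝓢(Euc n, Elastic2 𝕜 n)) (ξ : Euc n) (i j k l : Fin n) :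
    fourierTensor f ξ i j k l = fourierTensor f ξ k l i j := by
  have h : component f i j k l = component f k l i j := by
    ext x
    rw [component_apply, component_apply, ((f x).2 i j k l).2]
  simp only [fourierTensor, h]

theorem sum_fourierTensor_of_mem_ker_Hstar {f : 𝓢(Euc n, Elastic2 𝕜 n)} (hf : Hstar 𝕜 n f = 0)
    {ξ : Euc n} (i j : Fin n) : ∑ k, ∑ l, fourierTensor f ξ i j k l * ξ k * ξ l = 0 := by
  have h : ∑ k, ∑ l, ∂_{EuclideanSpace.single k (1 : ℝ)} (∂_{EuclideanSpace.single l (1 : ℝ)}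
      (component f i j k l)) = 0 := by
    ext x
    have hx : RCLike.map 𝕜 ℂ ((Hstar 𝕜 n f x).1 i j) = 0 := by simp [hf]
    change RCLike.map 𝕜 ℂ (∑ k, ∑ l, (D 𝕜 n (Fin n → Elastic2 𝕜 n)
      (D 𝕜 n (Elastic2 𝕜 n) f) x k l).1 i j k l) = 0 at hx
    simp only [map_sum] at hx
    simp only [sum_apply, component, ← D_D_apply 𝕜 f]
    exact hx
  have h2 := congrArg (fun g : 𝓢(Euc n, ℂ) => 𝓕 g ξ) h
  simp only [FourierTransform.fourier_sum, sum_apply, fourier_lineDeriv_apply, EuclideanSpace.inner_single_right,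
    FourierTransform.fourier_zero, zero_apply] at h2
  -- Each derivative contributes `2πi` times a coordinate of `ξ`; the common constant is divided
  -- out.
  have hc : (2 * Real.pi * Complex.I) ^ 2 ≠ 0 := by simp [Real.pi_ne_zero]
  refine (mul_eq_zero.1 ?_).resolve_left hc
  rw [Finset.mul_sum, ← h2]
  refine Finset.sum_congr rfl fun k _ => ?_
  rw [Finset.mul_sum]
  refine Finset.sum_congr rfl fun l _ => ?_
  simp [fourierTensor]
  ring

theorem sum_fourierTensor_of_mem_ker_Kstar {f : 𝓢(Euc n, Elastic2 𝕜 n)} (hf : Kstar 𝕜 n f = 0)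
    {ξ : Euc n} (i : Fin n) : ∑ j, ∑ k, fourierTensor f ξ i j k k * ξ j = 0 := by
  have h : ∑ j, ∑ k, ∂_{EuclideanSpace.single j (1 : ℝ)} (component f i j k k) = 0 := by
    ext x
    have hx : RCLike.map 𝕜 ℂ (- Kstar 𝕜 n f x i) = 0 := by simp [hf]
    change RCLike.map 𝕜 ℂ (- - ∑ j, ∑ k, (D 𝕜 n (Elastic2 𝕜 n) f x j).1 i j k k) = 0 at hx
    simp only [neg_neg, map_sum] at hx
    simp only [sum_apply, component, ← D_apply 𝕜 f]
    exact hx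
  have h2 := congrArg (fun g : 𝓢(Euc n, ℂ) => 𝓕 g ξ) h
  simp only [FourierTransform.fourier_sum, sum_apply, fourier_lineDeriv_apply, EuclideanSpace.inner_single_right,
    FourierTransform.fourier_zero, zero_apply] at h2
  have hc : 2 * Real.pi * Complex.I ≠ 0 := by simp [Real.pi_ne_zero]
  refine (mul_eq_zero.1 ?_).resolve_left hc
  rw [Finset.mul_sum, ← h2]
  refine Finset.sum_congr rfl fun j _ => ?_
  rw [Finset.mul_sum]
  refine Finset.sum_congr rfl fun k _ => ?_
  simp [fourierTensor]
  ring

theorem contract4_fourierTensor_of_mem_kerXray {f : 𝓢(Euc n, Elastic2 𝕜 n)}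
    (hf : f ∈ kerXray 𝕜 n) {v q ξ : Euc n} (hv : ‖v‖ = 1) (hq : q ∈ polarizations v)
    (hξ : ⟪v, ξ⟫ = 0) : contract4 (fourierTensor f ξ) v q v q = 0 := by
  let g : 𝓢(Euc n, ℂ) :=
    ∑ i, ∑ j, ∑ k, ∑ l, ((v i : ℂ) * q j * v k * q l) • component f i j k l
  have hg (x : Euc n) : g x = RCLike.map 𝕜 ℂ (contract4 (f x).1 v q v q) := by
    simp only [g, sum_apply, smul_apply, component_apply, contract4_apply, map_sum]
    refine Finset.sum_congr rfl fun i _ => Finset.sum_congr rfl fun j _ =>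
      Finset.sum_congr rfl fun k _ => Finset.sum_congr rfl fun l _ => ?_
    have : (f x).1 i j k l * (v i : 𝕜) * (q j : 𝕜) * (v k : 𝕜) * (q l : 𝕜) =
        (v i * q j * v k * q l) • (f x).1 i j k l := by
      rw [RCLike.real_smul_eq_coe_mul]
      push_cast
      ring
    rw [this, map_smul, Complex.real_smul]
    push_cast
    rfl
  have h0 : 𝓕 g ξ = 0 := by
    refine fourier_eq_zero_of_integral_line_eq_zero g hv hξ fun x => ?_
    have hi : Integrable fun t : ℝ => contract4 (f (x + t • v)).1 v q v q := by
      simpa only [contractVQ_eq_contract4] using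
        integrable_contractVQ ⟨v, mem_sphere_zero_iff_norm.2 hv⟩ q f x
    simp only [hg]
    rw [(RCLike.map 𝕜 ℂ).integral_comp_comm hi, (mem_kerXray 𝕜).1 hf v hv q hq x, map_zero]
  rw [← h0]
  simp only [g, FourierTransform.fourier_sum, sum_apply, FourierTransform.fourier_smul, smul_apply, contract4_apply]
  refine Finset.sum_congr rfl fun i _ => Finset.sum_congr rfl fun j _ =>
    Finset.sum_congr rfl fun k _ => Finset.sum_congr rfl fun l _ => ?_
  simp only [fourierTensor, smul_eq_mul, Complex.coe_algebraMap]
  ring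

theorem fourierTensor_eq_zero {f : 𝓢(Euc n, Elastic2 𝕜 n)} (hH : Hstar 𝕜 n f = 0)
    (hK : Kstar 𝕜 n f = 0) (hX : f ∈ kerXray 𝕜 n) {ξ : Euc n} (hξ : ξ ≠ 0) :
    fourierTensor f ξ = 0 := by
  set a := fourierTensor f ξ with ha
  have hs1 : (fun i j k l => a j i k l) = a := by
    funext i j k l
    exact (fourierTensor_swap f ξ i j k l).symm
  have hs2 : (fun i j k l => a k l i j) = a := by
    funext i j k l
    exact (fourierTensor_swap_pairs f ξ i j k l).symm
  have s1 (x y z w) : contract4 a x y z w = contract4 a y x z w := by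
    rw [← contract4_swap_left a, hs1]
  have s2 (x y z w) : contract4 a x y z w = contract4 a z w x y := by
    rw [← contract4_swap_pairs a, hs2]
  have hn : ‖ξ‖ ≠ 0 := norm_ne_zero_iff.2 hξ
  have orth (v : Euc n) : ⟪v, ‖ξ‖⁻¹ • ξ⟫ = 0 ↔ ⟪v, ξ⟫ = 0 := by
    simp [inner_smul_right, hξ]
  have trans (v q : Euc n) (hv : ⟪v, ξ⟫ = 0) (hq : q ∈ polarizations v) :
      contract4 a v q v q = 0 := by
    rcases eq_or_ne v 0 with rfl | hv0
    · simp
    have hvn : ‖v‖ ≠ 0 := norm_ne_zero_iff.2 hv0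
    -- The polarization set depends only on the line through `v`, and the contraction is homogeneous
    -- in `v`, so normalizing `v` loses nothing.
    have h := contract4_fourierTensor_of_mem_kerXray hX (v := ‖v‖⁻¹ • v) (q := q) (ξ := ξ)
      (by rw [norm_smul, norm_inv, norm_norm, inv_mul_cancel₀ hvn])
      (by rwa [polarizations, Submodule.span_singleton_smul_eq (IsUnit.mk0 _ (inv_ne_zero hvn))])
      (by rw [inner_smul_left, hv, mul_zero])
    simpa [hv0, ← ha] using h
  have key := elastic_eq_zero (A := contract4 a) (EuclideanSpace.basisFun (Fin n) ℝ) s1 s2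
    (e := ‖ξ‖⁻¹ • ξ) (by rw [norm_smul, norm_inv, norm_norm, inv_mul_cancel₀ hn])
    (fun v hv => trans v v ((orth v).1 hv) (.inl (Submodule.mem_span_singleton_self v)))
    (fun v q hv hq => trans v q ((orth v).1 hv)
      (.inr (Submodule.mem_orthogonal_singleton_iff_inner_right.2 hq)))
    (fun x y => by
      have h : contract4 a x y ξ ξ = 0 := by
        rw [contract4_apply]
        refine Finset.sum_eq_zero fun i _ => Finset.sum_eq_zero fun j _ => ?_
        have := sum_fourierTensor_of_mem_ker_Hstar hH (ξ := ξ) i j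
        rw [← mul_zero ((x i : ℂ) * y j), ← this, Finset.mul_sum]
        refine Finset.sum_congr rfl fun k _ => ?_
        rw [Finset.mul_sum]
        refine Finset.sum_congr rfl fun l _ => ?_
        simp only [a, RCLike.ofReal_eq_complex_ofReal]
        ring
      simp [h])
    (fun u => by
      have h : ∑ k, contract4 a u ξ (EuclideanSpace.single k 1) (EuclideanSpace.single k 1) = 0 := by
        simp only [contract4_apply]
        rw [Finset.sum_comm]
        refine Finset.sum_eq_zero fun i _ => ?_
        have := sum_fourierTensor_of_mem_ker_Kstar hK (ξ := ξ) i
        rw [← mul_zero (u i : ℂ), ← this, Finset.mul_sum, Finset.sum_comm]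
        refine Finset.sum_congr rfl fun j _ => ?_
        rw [Finset.mul_sum]
        refine Finset.sum_congr rfl fun k _ => ?_
        simp [a]
        ring
      simp only [EuclideanSpace.basisFun_apply, map_smul, LinearMap.smul_apply, ← Finset.smul_sum,
        h, smul_zero])
  funext i j k l
  have := key (EuclideanSpace.single i 1) (EuclideanSpace.single j 1) (EuclideanSpace.single k 1)
    (EuclideanSpace.single l 1)
  simpa [contract4_apply, Pi.single_apply] using this

theorem eq_zero_of_mem_ker (hn : 1 ≤ n) {f : 𝓢(Euc n, Elastic2 𝕜 n)} (hH : Hstar 𝕜 n f = 0)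
    (hK : Kstar 𝕜 n f = 0) (hX : f ∈ kerXray 𝕜 n) : f = 0 := by
  -- With `n ≥ 1` the space is nontrivial, so the complement of the origin is dense.
  have : Nonempty (Fin n) := ⟨⟨0, hn⟩⟩
  have hcomp (i j k l : Fin n) : component f i j k l = 0 := by
    have hd : ⇑(𝓕 (component f i j k l) : 𝓢(Euc n, ℂ)) = 0 := by
      refine Continuous.ext_on (dense_compl_singleton (0 : Euc n))
        (SchwartzMap.continuous _) continuous_const fun ξ hξ => ?_
      exact congrFun (congrFun (congrFun (congrFun (fourierTensor_eq_zero hH hK hX hξ) i) j) k) l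
    have h : (𝓕 (component f i j k l) : 𝓢(Euc n, ℂ)) = 0 := DFunLike.coe_injective hd
    rw [← FourierTransform.fourierInv_fourier_eq (F := 𝓢(Euc n, ℂ)) (component f i j k l), h,
      FourierTransform.fourierInv_zero]
  ext x i j k l
  have h := DFunLike.congr_fun (hcomp i j k l) x
  rw [component_apply] at h
  have hr : RCLike.re ((f x).1 i j k l) = 0 := by simpa using congrArg Complex.re h
  have hi : RCLike.im ((f x).1 i j k l) = 0 := by simpa using congrArg Complex.im h
  exact RCLike.ext (by simpa using hr) (by simpa using hi)

set_option synthInstance.maxHeartbeats 400000 in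
theorem ker_inf_eq_bot (hn : 1 ≤ n) :
    LinearMap.ker (Hstar 𝕜 n).toLinearMap ⊓ LinearMap.ker (Kstar 𝕜 n).toLinearMap ⊓
      kerXray 𝕜 n = ⊥ := by
  rw [Submodule.eq_bot_iff]
  rintro f ⟨⟨hH, hK⟩, hX⟩
  exact eq_zero_of_mem_ker hn hH hK hX

end Gauge

end ElasticXRay

end

theorem theorem1p2 (𝕜 : Type*) [RCLike 𝕜] (n : ℕ) (hn : 1 ≤ n) :
    LinearMap.range (ElasticXRay.H 𝕜 n).toLinearMap ⊔
        LinearMap.range (ElasticXRay.K 𝕜 n).toLinearMap ≤ ElasticXRay.kerXray 𝕜 n ∧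
      LinearMap.ker (ElasticXRay.Hstar 𝕜 n).toLinearMap ⊓
        LinearMap.ker (ElasticXRay.Kstar 𝕜 n).toLinearMap ⊓ ElasticXRay.kerXray 𝕜 n = ⊥ := by
  exact ⟨sup_le (ElasticXRay.range_H_le_kerXray 𝕜) (ElasticXRay.range_K_le_kerXray 𝕜),
    ElasticXRay.ker_inf_eq_bot hn⟩
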